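/- Fix $d\in\mathbb N$, $\beta>0$, an action set $\mathcal A\subseteq\mathbb R^d$ contained in the closed Euclidean unit ball and a parameter set $\mathcal O\subseteq\mathcal A$ contained in the unit sphere; both may be infinite. Let $\phi_\beta(x)=e^{\beta x}/(1+e^{\beta x})$ and let $\pi^\star$ be a map with $\pi^\star(\theta)\in\operatorname{argmax}_{a\in\mathcal A}\phi_\beta(\langle a,\theta\rangle)$ for $\theta\in\mathcal O$. The unknown parameter $\Theta$ is a random variable with values in $\mathcal O$ (its law is the prior). Playing action $a$ yields a reward $R(a,\Theta)\in\{0,1\}$ which, given $\Theta=\theta$ and the past, equals $1$ with probability $\phi_\beta(\langle a,\theta\rangle)$. Let $T\ge 1$. In each round $t=1,\dots,T$, Thompson Sampling draws, given $\Theta$ and the history $H^t=(A_1,R_1,\dots,A_{t-1},R_{t-1})$, an estimate $\hat\Theta_t$ from the posterior law $\mathbb P_{\Theta\mid H^t}$, plays $A_t=\pi^\star(\hat\Theta_t)$, and receives $R_t=R(A_t,\Theta)$. Put $A^\star=\pi^\star(\Theta)$ and $$\mathbb E[\mathrm{Regret}(T)]=\mathbb E\Big[\sum_{t=1}^T \big(R(A^\star,\Theta)-R(A_t,\Theta)\big)\Big].$$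 The information ratio in round $t$ is the $[0,\infty]$-valued random variable $$\Gamma_t=\frac{\mathbb E[R(A^\star,\Theta)-R(A_t,\Theta)\mid H^t]^2}{\mathrm I_t(A^\star;R(A_t,\Theta),A_t)},$$ where $\mathrm I_t(A^\star;R(A_t,\Theta),A_t)$ is the mutual information (in nats) between $A^\star$ and the pair $(R(A_t,\Theta),A_t)$ under their joint conditional law given $H^t$, and $0/0=0$, $c/0=\infty$ for $c>0$. Let $\varepsilon>0$, let $\mathcal O_\varepsilon\subseteq\mathcal O$ be an $\varepsilon$-net of $\mathcal O$ for the Euclidean distance, let $q:\mathcal O\to\mathcal O_\varepsilon$ be a measurable map with $\|\theta-q(\theta)\|\le\varepsilon$ for all $\theta\in\mathcal O$, and let $\Theta_\varepsilon=q(\Theta)$. Let $\mathrm H(\Theta_\varepsilon)\in[0,\infty]$ be its Shannon entropy in nats ($\infty$ if $\Theta_\varepsilon$ is not discrete). **Theorem.** If $\frac1T\sum_{t=1}^T\mathbb E[\Gamma_t]\le\Gamma$ for some real $\Gamma>0$, then $$\mathbb E[\mathrm{Regret}(T)]\le\sqrt{\Gamma\,T\,\big(\mathrm H(\Theta_\varepsilon)+\varepsilon\beta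 T\big)}.$$ -/

import Mathlib

open MeasureTheory ProbabilityTheory InformationTheory
open scoped ENNReal

noncomputable section

namespace LogisticBandit

/-- The logistic (link) function `φ_β(x) = e^{βx} / (1 + e^{βx})`. -/
def logistic (β x : ℝ) : ℝ := Real.exp (β * x) / (1 + Real.exp (β * x))

/-- The numerical value in `{0, 1}` of a binary reward. -/
def rewardValue (r : Bool) : ℝ := if r then 1 else 0

/-- `π` is an optimal mapping: for every parameter `θ ∈ O`, the action `π θ ∈ A` maximizes the
expected reward `E[R(a, θ)] = φ_β(⟪a, θ⟫)` over the actions `a ∈ A`. -/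
def IsOptimalMapping {d : ℕ} (β : ℝ) (A O : Set (EuclideanSpace ℝ (Fin d)))
    (π : EuclideanSpace ℝ (Fin d) → EuclideanSpace ℝ (Fin d)) : Prop :=
  ∀ θ ∈ O, π θ ∈ A ∧ ∀ a ∈ A, logistic β (inner ℝ a θ) ≤ logistic β (inner ℝ (π θ) θ)

/-- `N` is an `ε`-net of `O` (for the Euclidean distance), with associated projection `q`. -/
structure IsNetProjection {d : ℕ} (O N : Set (EuclideanSpace ℝ (Fin d))) (ε : ℝ)
    (q : EuclideanSpace ℝ (Fin d) → EuclideanSpace ℝ (Fin d)) : Prop where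
  subset : N ⊆ O
  measurable : Measurable q
  mapsTo : ∀ θ ∈ O, q θ ∈ N
  dist_le : ∀ θ ∈ O, dist θ (q θ) ≤ ε

/-- The history before round `t` (rounds are numbered from `0`): the actions `π (Θhat s)` and
the rewards `R s` for `s < t`. -/
def history {Ω : Type*} {d : ℕ} (π : EuclideanSpace ℝ (Fin d) → EuclideanSpace ℝ (Fin d))
    (Θhat : ℕ → Ω → EuclideanSpace ℝ (Fin d)) (R : ℕ → Ω → Bool) (t : ℕ) (ω : Ω) :
    Fin t → EuclideanSpace ℝ (Fin d) × Bool :=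
  fun s => (π (Θhat s ω), R s ω)

/-- Thompson Sampling run for `T` rounds on a logistic bandit. `Θ` is the unknown parameter (its
law under `μ` is the prior), `Θhat t` is the sampled estimate and `π (Θhat t)` the action of round
`t`, `R t` is the reward received in round `t`, and `Ropt t` is the reward that the optimal action
`π Θ` gives in round `t`. -/
structure IsThompsonSampling {Ω : Type*} [MeasurableSpace Ω] {d : ℕ} (μ : Measure Ω) (β : ℝ)
    (π : EuclideanSpace ℝ (Fin d) → EuclideanSpace ℝ (Fin d)) (T : ℕ)
    (Θ : Ω → EuclideanSpace ℝ (Fin d)) (Θhat : ℕ → Ω → EuclideanSpace ℝ (Fin d))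
    (R Ropt : ℕ → Ω → Bool) : Prop where
  measurable_param : Measurable Θ
  measurable_estimate : ∀ t, Measurable (Θhat t)
  measurable_reward : ∀ t, Measurable (R t)
  measurable_optReward : ∀ t, Measurable (Ropt t)
  /-- Given the parameter and the history, the estimate is drawn from the posterior
  distribution of the parameter given the history. -/
  sampling : ∀ t < T, ∀ B : Set (EuclideanSpace ℝ (Fin d)), MeasurableSet B →
    μ⟦Θhat t ⁻¹' B | MeasurableSpace.comap (fun ω => (Θ ω, history π Θhat R t ω)) inferInstance⟧
      =ᵐ[μ] μ⟦Θ ⁻¹' B | MeasurableSpace.comap (history π Θhat R t) inferInstance⟧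
  /-- Given the parameter, the history and the action `a` of the round, the reward is `1` with
  probability `φ_β(⟪a, Θ⟫)`. -/
  reward : ∀ t < T,
    μ[fun ω => rewardValue (R t ω) | MeasurableSpace.comap
        (fun ω => (Θ ω, history π Θhat R t ω, π (Θhat t ω))) inferInstance]
      =ᵐ[μ] fun ω => logistic β (inner ℝ (π (Θhat t ω)) (Θ ω))
  /-- Given the parameter and the history, the reward of the optimal action is `1` with
  probability `φ_β(⟪π Θ, Θ⟫)`. -/
  optReward : ∀ t < T,
    μ[fun ω => rewardValue (Ropt t ω) | MeasurableSpace.comap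
        (fun ω => (Θ ω, history π Θhat R t ω)) inferInstance]
      =ᵐ[μ] fun ω => logistic β (inner ℝ (π (Θ ω)) (Θ ω))

/-- The expected regret `E[∑_t (R(A⋆, Θ) - R(A_t, Θ))]` over `T` rounds. -/
def expectedRegret {Ω : Type*} [MeasurableSpace Ω] (μ : Measure Ω) (R Ropt : ℕ → Ω → Bool)
    (T : ℕ) : ℝ :=
  ∫ ω, ∑ t ∈ Finset.range T, (rewardValue (Ropt t ω) - rewardValue (R t ω)) ∂μ

/-- The disintegrated mutual information between `X` and `Y` given `Z = Z ω`: the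
Kullback-Leibler divergence (in nats) of the conditional joint law of `(X, Y)` given `Z = Z ω`
from the product of its two marginals. -/
def condMutualInfo {Ω 𝓧 𝓨 𝓩 : Type*} [MeasurableSpace Ω] [MeasurableSpace 𝓧] [MeasurableSpace 𝓨]
    [MeasurableSpace 𝓩] [StandardBorelSpace 𝓧] [StandardBorelSpace 𝓨] [Nonempty 𝓧] [Nonempty 𝓨]
    (μ : Measure Ω) [IsFiniteMeasure μ] (X : Ω → 𝓧) (Y : Ω → 𝓨) (Z : Ω → 𝓩) (ω : Ω) : ℝ≥0∞ :=
  klDiv (condDistrib (fun ω' => (X ω', Y ω')) Z μ (Z ω))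
    ((condDistrib (fun ω' => (X ω', Y ω')) Z μ (Z ω)).fst.prod
      (condDistrib (fun ω' => (X ω', Y ω')) Z μ (Z ω)).snd)

/-- The Thompson Sampling information ratio
`Γ_t = E_t[R(A⋆, Θ) - R(A_t, Θ)]² / I_t(A⋆; R(A_t, Θ), A_t)`, a `[0, ∞]`-valued random variable,
where `0 / 0 = 0` and `c / 0 = ∞` for `c > 0`. -/
def infoRatio {Ω : Type*} [MeasurableSpace Ω] {d : ℕ} (μ : Measure Ω) [IsFiniteMeasure μ]
    (π : EuclideanSpace ℝ (Fin d) → EuclideanSpace ℝ (Fin d))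
    (Θ : Ω → EuclideanSpace ℝ (Fin d)) (Θhat : ℕ → Ω → EuclideanSpace ℝ (Fin d))
    (R Ropt : ℕ → Ω → Bool) (t : ℕ) (ω : Ω) : ℝ≥0∞ :=
  ENNReal.ofReal ((μ[fun ω' => rewardValue (Ropt t ω') - rewardValue (R t ω') |
      MeasurableSpace.comap (history π Θhat R t) inferInstance] ω) ^ 2) /
    condMutualInfo μ (fun ω' => π (Θ ω')) (fun ω' => (R t ω', π (Θhat t ω')))
      (history π Θhat R t) ω

open Classical in
/-- Shannon entropy (in nats) of a random variable: `∑ P(X = x) log (1 / P(X = x))` if `X` is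
discrete, that is, almost surely in some countable set, and `∞` otherwise. -/
def entropy {Ω 𝓧 : Type*} [MeasurableSpace Ω] (μ : Measure Ω) (X : Ω → 𝓧) : ℝ≥0∞ :=
  if ∃ S : Set 𝓧, S.Countable ∧ ∀ᵐ ω ∂μ, X ω ∈ S then
    ∑' x, ENNReal.ofReal (Real.negMulLog (μ.real (X ⁻¹' {x})))
  else ∞

end LogisticBandit

end

/-!
Since `φ_β` is increasing, `O` lies on the unit sphere and `O ⊆ A ⊆` unit ball, an optimal mapping
fixes every `θ ∈ O`; so the optimal action is `Θ` itself, almost surely.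

The information gained in one round is bounded by comparison with a forecaster. Given the history,
`Θ` and the action are independent, so the joint law of the optimal action, the reward and the
action has an explicit density, and the chain rule for the Kullback-Leibler divergence gives, for
*every* probabilistic forecast `g` of the reward from the history and the action,
`I_t(A⋆; R_t, A_t) ≤ E[log (p(R_t | A_t, Θ) / g(R_t | A_t, H^t)) | H^t]`
(`condMutualInfo_le_condExp_log`; equality would hold for the posterior predictive law).

The forecaster used here is the Bayesian mixture whose prior is the law of `q(Θ)`. Its
forecasts are ratios of successive mixture likelihoods `m_t = ∫ L_t(v) dP_{q(Θ)}(v)`, so the log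
losses telescope and the sum over the rounds is `log (L_T(Θ) / m_T)`. Keeping only the atom `q(Θ)`
of the mixture and using that `log φ_β` is `β`-Lipschitz, this is at most
`-log P(q(Θ) = q(Θ(ω))) + ε β T` pointwise (`log_likelihood_div_mixtureLikelihood_le`), whose
expectation is `H(Θ_ε) + ε β T`. Thus the expected informations sum to at most this
(`IsThompsonSampling.sum_lintegral_condExp_excessLogLoss_le`), with no chain rule for mutual
information over the rounds.

The regret bound follows by applying the Cauchy-Schwarz inequality in each round
(`ofReal_integral_le_of_sq_div_le`) and then to the sum over the rounds (`sum_rpow_half_mul_le`).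
-/

namespace LogisticBandit

/-! ### Kullback-Leibler divergence -/

/-- Among the product measures with first factor the first marginal of `ρ`, the divergence of `ρ` is
smallest for the product of its two marginals: the excess for another second factor `Q` is the
divergence of the second marginal from `Q`, by the chain rule. -/
theorem klDiv_fst_prod_snd_le {𝓧 𝓨 : Type*} [MeasurableSpace 𝓧] [MeasurableSpace 𝓨]
    [StandardBorelSpace 𝓧] [Nonempty 𝓧] (ρ : Measure (𝓧 × 𝓨)) [IsProbabilityMeasure ρ]
    (Q : Measure 𝓨) [IsProbabilityMeasure Q] :
    klDiv ρ (ρ.fst.prod ρ.snd) ≤ klDiv ρ (ρ.fst.prod Q) := by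
  have hdis : ρ.map Prod.swap = ρ.snd ⊗ₘ (ρ.map Prod.swap).condKernel := by
    rw [← Measure.fst_map_swap, Measure.disintegrate]
  have hswap : (ρ.map Prod.swap).map Prod.swap = ρ := by
    rw [Measure.map_map measurable_swap measurable_swap, Prod.swap_swap_eq, Measure.map_id]
  calc klDiv ρ (ρ.fst.prod ρ.snd)
      = klDiv ((ρ.map Prod.swap).map Prod.swap) ((ρ.snd.prod ρ.fst).map Prod.swap) := by
        rw [hswap, Measure.prod_swap]
    _ ≤ klDiv (ρ.map Prod.swap) (ρ.snd.prod ρ.fst) := klDiv_map_le _ _ measurable_swap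
    _ ≤ klDiv (ρ.map Prod.swap) (Q.prod ρ.fst) := by
        rw [← Measure.compProd_const, ← Measure.compProd_const, hdis,
          klDiv_compProd_eq_add ρ.snd Q]
        exact le_add_self
    _ = klDiv (ρ.map Prod.swap) ((ρ.fst.prod Q).map Prod.swap) := by rw [Measure.prod_swap]
    _ ≤ klDiv ρ (ρ.fst.prod Q) := klDiv_map_le _ _ measurable_swap

theorem klDiv_withDensity_ofReal {𝓧 : Type*} [MeasurableSpace 𝓧] (ν : Measure 𝓧)
    [IsProbabilityMeasure ν] {f : 𝓧 → ℝ} (hf : Measurable f) (hpos : ∀ x, 0 < f x)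
    [IsProbabilityMeasure (ν.withDensity fun x => ENNReal.ofReal (f x))]
    (hint : Integrable (fun x => Real.log (f x)) (ν.withDensity fun x => ENNReal.ofReal (f x))) :
    0 ≤ ∫ x, Real.log (f x) ∂(ν.withDensity fun x => ENNReal.ofReal (f x)) ∧
    klDiv (ν.withDensity fun x => ENNReal.ofReal (f x)) ν =
      ENNReal.ofReal (∫ x, Real.log (f x) ∂(ν.withDensity fun x => ENNReal.ofReal (f x))) := by
  set ρ := ν.withDensity fun x => ENNReal.ofReal (f x)
  have hac : ρ ≪ ν := withDensity_absolutelyContinuous _ _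
  have hllr : llr ρ ν =ᵐ[ρ] fun x => Real.log (f x) := by
    filter_upwards [hac.ae_le (Measure.rnDeriv_withDensity ν hf.ennreal_ofReal)] with x hx
    rw [llr, hx, ENNReal.toReal_ofReal (hpos x).le]
  have hint' : Integrable (llr ρ ν) ρ := hint.congr hllr.symm
  rw [← integral_congr_ae hllr]
  have h0 := integral_llr_add_sub_measure_univ_nonneg hac hint'
  rw [klDiv_of_ac_of_integrable hac hint']
  simp only [probReal_univ, add_sub_cancel_right] at h0 ⊢
  exact ⟨h0, trivial⟩

theorem abs_log_div_le {δ a b : ℝ} (hδ : 0 < δ) (ha : δ ≤ a) (ha1 : a ≤ 1) (hb : δ ≤ b)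
    (hb1 : b ≤ 1) : |Real.log (a / b)| ≤ -Real.log δ := by
  have ha0 := hδ.trans_le ha
  have hb0 := hδ.trans_le hb
  rw [Real.log_div ha0.ne' hb0.ne', abs_le]
  have h1 := Real.log_le_log hδ ha
  have h2 := Real.log_le_log hδ hb
  have h3 := Real.log_nonpos ha0.le ha1
  have h4 := Real.log_nonpos hb0.le hb1
  constructor <;> linarith

/-- The mutual information of a joint law with density `f` with respect to `P.prod b`, where
`f (x, ·)` is a conditional density, is at most the mean log-loss of any density `g` on the second
space, in excess over that of `f`. The reference measure `b` need not be a probability measure. -/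
theorem klDiv_fst_prod_snd_le_integral_log {𝓧 𝓨 : Type*} [MeasurableSpace 𝓧] [MeasurableSpace 𝓨]
    [StandardBorelSpace 𝓧] [Nonempty 𝓧] (P : Measure 𝓧) [IsProbabilityMeasure P]
    (b : Measure 𝓨) [IsFiniteMeasure b] {f : 𝓧 × 𝓨 → ℝ} {g : 𝓨 → ℝ} (hf : Measurable f)
    (hg : Measurable g) {δ : ℝ} (hδ : 0 < δ) (hfδ : ∀ z, δ ≤ f z) (hf1 : ∀ z, f z ≤ 1)
    (hgδ : ∀ y, δ ≤ g y) (hg1 : ∀ y, g y ≤ 1)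
    (hfb : ∀ x, ∫⁻ y, ENNReal.ofReal (f (x, y)) ∂b = 1)
    (hgb : ∫⁻ y, ENNReal.ofReal (g y) ∂b = 1)
    {ρ : Measure (𝓧 × 𝓨)} (hρ : ρ = (P.prod b).withDensity fun z => ENNReal.ofReal (f z)) :
    0 ≤ ∫ z, Real.log (f z / g z.2) ∂ρ ∧
    klDiv ρ (ρ.fst.prod ρ.snd) ≤ ENNReal.ofReal (∫ z, Real.log (f z / g z.2) ∂ρ) := by
  have hfpos z : 0 < f z := hδ.trans_le (hfδ z)
  have hgpos y : 0 < g y := hδ.trans_le (hgδ y)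
  have hfst : ρ.fst = P := by
    ext s hs
    rw [Measure.fst_apply hs, hρ, withDensity_apply _ (measurable_fst hs),
      ← Set.prod_univ, ← Measure.prod_restrict, lintegral_prod _ (by fun_prop)]
    simp [hfb]
  have hρ1 : IsProbabilityMeasure ρ := ⟨by rw [← Measure.fst_univ, hfst, measure_univ]⟩
  set Q := b.withDensity fun y => ENNReal.ofReal (g y) with hQ
  have hQ1 : IsProbabilityMeasure Q := ⟨by
    rw [hQ, withDensity_apply _ .univ, Measure.restrict_univ, hgb]⟩
  have hρQ : ρ = (P.prod Q).withDensity fun z => ENNReal.ofReal (f z / g z.2) := by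
    rw [hQ, prod_withDensity_right (by fun_prop), ← withDensity_mul _ (by fun_prop) (by fun_prop),
      hρ]
    congr 1 with z
    rw [Pi.mul_apply, ← ENNReal.ofReal_mul (hgpos _).le, mul_div_cancel₀ _ (hgpos _).ne']
  have hm : Measurable fun z : 𝓧 × 𝓨 => f z / g z.2 := by fun_prop
  have hint : Integrable (fun z => Real.log (f z / g z.2)) ρ := by
    refine Integrable.of_bound (C := -Real.log δ)
      (Real.measurable_log.comp hm).aestronglyMeasurable (.of_forall fun z => ?_)
    exact abs_log_div_le hδ (hfδ z) (hf1 z) (hgδ z.2) (hg1 z.2)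
  have hle := klDiv_fst_prod_snd_le ρ Q
  rw [hfst] at hle ⊢
  rw [hρQ] at hint hρ1
  have key := klDiv_withDensity_ofReal (P.prod Q) hm (fun z => div_pos (hfpos _) (hgpos _)) hint
  rw [← hρQ] at key
  exact ⟨key.1, hle.trans key.2.le⟩

/-! ### Information gained in one round -/

theorem map_prodMk_eq_compProd_of_condExp {Ω 𝓩 𝓨 : Type*} [MeasurableSpace Ω] [MeasurableSpace 𝓩]
    [MeasurableSpace 𝓨] (μ : Measure Ω) [IsProbabilityMeasure μ] {Z : Ω → 𝓩} {Y : Ω → 𝓨}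
    (hZ : Measurable Z) (hY : Measurable Y) (κ : Kernel 𝓩 𝓨) [IsMarkovKernel κ]
    (h : ∀ B, MeasurableSet B →
      μ⟦Y ⁻¹' B | MeasurableSpace.comap Z inferInstance⟧ =ᵐ[μ] fun ω => (κ (Z ω)).real B) :
    μ.map (fun ω => (Z ω, Y ω)) = μ.map Z ⊗ₘ κ := by
  refine Measure.ext_prod fun {s B} hs hB => ?_
  have hsZ : MeasurableSet[MeasurableSpace.comap Z inferInstance] (Z ⁻¹' s) := ⟨s, hs, rfl⟩
  have hint : Integrable ((Y ⁻¹' B).indicator fun _ => (1 : ℝ)) μ :=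
    (integrable_const 1).indicator (hY hB)
  have h1 := setIntegral_condExp hZ.comap_le hint hsZ
  rw [setIntegral_congr_ae (g := fun ω => (κ (Z ω)).real B) (hZ hs)
    ((h B hB).mono fun _ h _ => h), setIntegral_indicator (hY hB), setIntegral_const,
    smul_eq_mul, mul_one] at h1
  rw [Measure.map_apply (hZ.prodMk hY) (hs.prod hB), Measure.compProd_apply_prod hs hB,
    setLIntegral_map hs (κ.measurable_coe hB) hZ, Set.mk_preimage_prod,
    ← ofReal_measureReal, ← h1, ofReal_integral_eq_lintegral_ofReal]
  · simp
  · refine Integrable.of_bound (C := 1)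
      ((κ.measurable_coe hB).comp hZ).ennreal_toReal.aestronglyMeasurable (.of_forall fun ω => ?_)
    rw [Real.norm_eq_abs, abs_of_nonneg measureReal_nonneg]
    exact measureReal_le_one
  · exact .of_forall fun ω => measureReal_nonneg

/-- If `X` and `A` are independent given `H`, with conditional laws `κX` and `κA`, and the binary
variable `R` equals `r` with conditional probability `p r A X` given `(H, X, A)`, then the
conditional law of `(X, R, A)` given `H` has density `p` with respect to the product of `κX`, the
counting measure and `κA`. -/
theorem map_eq_compProd_withDensity {Ω 𝓧 𝓐 𝓗 : Type*} [MeasurableSpace Ω] [MeasurableSpace 𝓧]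
    [MeasurableSpace 𝓐] [MeasurableSpace 𝓗] (μ : Measure Ω) [IsProbabilityMeasure μ]
    {X : Ω → 𝓧} {A : Ω → 𝓐} {R : Ω → Bool} {H : Ω → 𝓗} (hX : Measurable X) (hA : Measurable A)
    (hR : Measurable R) (hH : Measurable H) (κX : Kernel 𝓗 𝓧) [IsMarkovKernel κX]
    (κA : Kernel 𝓗 𝓐) [IsMarkovKernel κA]
    (hind : μ.map (fun ω => (H ω, X ω, A ω)) = μ.map H ⊗ₘ (κX ×ₖ κA))
    {p : Bool → 𝓐 → 𝓧 → ℝ≥0∞} (hp : ∀ r, Measurable fun z : 𝓐 × 𝓧 => p r z.1 z.2)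
    (hrew : ∀ r, ∀ S : Set (𝓗 × 𝓧 × 𝓐), MeasurableSet S →
      μ ((fun ω => (H ω, X ω, A ω)) ⁻¹' S ∩ R ⁻¹' {r}) =
        ∫⁻ ω in (fun ω => (H ω, X ω, A ω)) ⁻¹' S, p r (A ω) (X ω) ∂μ)
    (κ : Kernel 𝓗 (𝓧 × Bool × 𝓐)) [IsSFiniteKernel κ]
    (hκ : ∀ h, κ h = ((κX h).prod (Measure.count.prod (κA h))).withDensity
      fun z => p z.2.1 z.2.2 z.1) :
    μ.map (fun ω => (H ω, X ω, R ω, A ω)) = μ.map H ⊗ₘ κ := by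
  have hW : Measurable fun ω => (H ω, X ω, A ω) := by fun_prop
  have hmr r : (μ.restrict (R ⁻¹' {r})).map (fun ω => (H ω, X ω, A ω)) =
      (μ.withDensity fun ω => p r (A ω) (X ω)).map (fun ω => (H ω, X ω, A ω)) := by
    ext S hS
    rw [Measure.map_apply hW hS, Measure.map_apply hW hS, Measure.restrict_apply (hW hS),
      withDensity_apply _ (hW hS), hrew r S hS]
  have hp' : Measurable fun z : 𝓧 × Bool × 𝓐 => p z.2.1 z.2.2 z.1 := by
    have : Measurable fun z : Bool × 𝓐 × 𝓧 => p z.1 z.2.1 z.2.2 :=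
      measurable_from_prod_countable_right hp
    exact this.comp (by fun_prop : Measurable fun z : 𝓧 × Bool × 𝓐 => (z.2.1, z.2.2, z.1))
  refine Measure.ext_of_lintegral _ fun f hf => ?_
  have hfr r : Measurable fun w : 𝓗 × 𝓧 × 𝓐 => f (w.1, w.2.1, r, w.2.2) := by fun_prop
  have hpr r : Measurable fun w : 𝓗 × 𝓧 × 𝓐 => p r w.2.2 w.2.1 :=
    (hp r).comp (by fun_prop : Measurable fun w : 𝓗 × 𝓧 × 𝓐 => (w.2.2, w.2.1))
  have hpf r : Measurable fun w : 𝓗 × 𝓧 × 𝓐 => p r w.2.2 w.2.1 * f (w.1, w.2.1, r, w.2.2) :=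
    (hpr r).mul (hfr r)
  have hL r : ∫⁻ ω in R ⁻¹' {r}, f (H ω, X ω, R ω, A ω) ∂μ =
      ∫⁻ h, ∫⁻ x, ∫⁻ a, p r a x * f (h, x, r, a) ∂(κA h) ∂(κX h) ∂(μ.map H) := by
    calc ∫⁻ ω in R ⁻¹' {r}, f (H ω, X ω, R ω, A ω) ∂μ
        = ∫⁻ ω in R ⁻¹' {r}, f (H ω, X ω, r, A ω) ∂μ := by
          refine setLIntegral_congr_fun (hR (measurableSet_singleton r)) fun ω hω => ?_
          simp only [Set.mem_preimage, Set.mem_singleton_iff] at hω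
          simp only [hω]
      _ = ∫⁻ w, f (w.1, w.2.1, r, w.2.2)
            ∂((μ.restrict (R ⁻¹' {r})).map (fun ω => (H ω, X ω, A ω))) := by
          rw [lintegral_map (hfr r) hW]
      _ = ∫⁻ ω, p r (A ω) (X ω) * f (H ω, X ω, r, A ω) ∂μ := by
          rw [hmr, lintegral_map (hfr r) hW, lintegral_withDensity_eq_lintegral_mul]
          · rfl
          · exact (hpr r).comp hW
          · exact (hfr r).comp hW
      _ = ∫⁻ w, p r w.2.2 w.2.1 * f (w.1, w.2.1, r, w.2.2)
            ∂(μ.map (fun ω => (H ω, X ω, A ω))) := by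
          rw [lintegral_map (hpf r) hW]
      _ = _ := by
          rw [hind, Measure.lintegral_compProd (hpf r)]
          refine lintegral_congr fun h => ?_
          rw [Kernel.prod_apply, lintegral_prod]
          exact ((hpf r).comp measurable_prodMk_left).aemeasurable
  have hm r : Measurable fun h => ∫⁻ x, ∫⁻ a, p r a x * f (h, x, r, a) ∂(κA h) ∂(κX h) := by
    have h1 : Measurable fun w : 𝓗 × 𝓧 => ∫⁻ a, p r a w.2 * f (w.1, w.2, r, a) ∂(κA w.1) := by
      refine Measurable.lintegral_kernel_prod_right' (κ := κA.comap Prod.fst measurable_fst)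
        (f := fun w : (𝓗 × 𝓧) × 𝓐 => p r w.2 w.1.2 * f (w.1.1, w.1.2, r, w.2)) ?_
      exact ((hp r).comp (by fun_prop : Measurable fun w : (𝓗 × 𝓧) × 𝓐 => (w.2, w.1.2))).mul
        (by fun_prop)
    exact Measurable.lintegral_kernel_prod_right' h1
  have hsplit : ∫⁻ ω, f (H ω, X ω, R ω, A ω) ∂μ =
      ∫⁻ ω in R ⁻¹' {true}, f (H ω, X ω, R ω, A ω) ∂μ +
      ∫⁻ ω in R ⁻¹' {false}, f (H ω, X ω, R ω, A ω) ∂μ := by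
    have hc : R ⁻¹' {false} = (R ⁻¹' {true})ᶜ := by ext ω; simp
    rw [hc, lintegral_add_compl _ (hR (measurableSet_singleton _))]
  rw [lintegral_map hf (by fun_prop), hsplit, hL, hL, Measure.lintegral_compProd hf,
    ← lintegral_add_left (hm true)]
  refine lintegral_congr fun h => ?_
  have hfh : Measurable fun z => f (h, z) := hf.comp measurable_prodMk_left
  have hmul : Measurable fun z : 𝓧 × Bool × 𝓐 => p z.2.1 z.2.2 z.1 * f (h, z) := hp'.mul hfh
  rw [hκ, lintegral_withDensity_eq_lintegral_mul _ hp' hfh]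
  simp only [Pi.mul_apply]
  rw [lintegral_prod _ hmul.aemeasurable, ← lintegral_add_left]
  · refine lintegral_congr fun x => ?_
    have hx : Measurable fun y : Bool × 𝓐 => p y.1 y.2 x * f (h, x, y) :=
      hmul.comp measurable_prodMk_left
    rw [lintegral_prod _ hx.aemeasurable, lintegral_count, tsum_bool, add_comm]
  · refine Measurable.lintegral_prod_right'
      (f := fun w : 𝓧 × 𝓐 => p true w.2 w.1 * f (h, w.1, true, w.2)) ?_
    exact ((hp true).comp measurable_swap).mul (by fun_prop)

/-- The mutual information between `X` and `(R, A)` given `H` is at most the conditional mean of the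
log-loss of an arbitrary forecast `g` of `R` from `(H, A)`, in excess over that of the forecast `p`
that knows `X`. -/
theorem condMutualInfo_le_condExp_log {Ω 𝓧 𝓐 𝓗 : Type*} [MeasurableSpace Ω] [MeasurableSpace 𝓧]
    [MeasurableSpace 𝓐] [MeasurableSpace 𝓗] [StandardBorelSpace 𝓧] [StandardBorelSpace 𝓐]
    [Nonempty 𝓧] [Nonempty 𝓐] (μ : Measure Ω) [IsProbabilityMeasure μ]
    {X : Ω → 𝓧} {A : Ω → 𝓐} {R : Ω → Bool} {H : Ω → 𝓗} (hX : Measurable X) (hA : Measurable A)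
    (hR : Measurable R) (hH : Measurable H) (κX : Kernel 𝓗 𝓧) [IsMarkovKernel κX]
    (κA : Kernel 𝓗 𝓐) [IsMarkovKernel κA]
    (hind : μ.map (fun ω => (H ω, X ω, A ω)) = μ.map H ⊗ₘ (κX ×ₖ κA))
    {p : Bool → 𝓐 → 𝓧 → ℝ} (hp : ∀ r, Measurable fun z : 𝓐 × 𝓧 => p r z.1 z.2)
    (hrew : ∀ r, ∀ S : Set (𝓗 × 𝓧 × 𝓐), MeasurableSet S →
      μ ((fun ω => (H ω, X ω, A ω)) ⁻¹' S ∩ R ⁻¹' {r}) =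
        ∫⁻ ω in (fun ω => (H ω, X ω, A ω)) ⁻¹' S, ENNReal.ofReal (p r (A ω) (X ω)) ∂μ)
    {g : 𝓗 → Bool → 𝓐 → ℝ} (hg : ∀ r, Measurable fun z : 𝓗 × 𝓐 => g z.1 r z.2)
    {δ : ℝ} (hδ : 0 < δ) (hpδ : ∀ r a x, δ ≤ p r a x) (hps : ∀ a x, p true a x + p false a x = 1)
    (hgδ : ∀ h r a, δ ≤ g h r a) (hgs : ∀ h a, g h true a + g h false a = 1) :
    Integrable (fun ω => Real.log (p (R ω) (A ω) (X ω) / g (H ω) (R ω) (A ω))) μ ∧ ∀ᵐ ω ∂μ,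
      0 ≤ μ[fun ω' => Real.log (p (R ω') (A ω') (X ω') / g (H ω') (R ω') (A ω')) |
        MeasurableSpace.comap H inferInstance] ω ∧
      condMutualInfo μ X (fun ω' => (R ω', A ω')) H ω ≤ ENNReal.ofReal
        (μ[fun ω' => Real.log (p (R ω') (A ω') (X ω') / g (H ω') (R ω') (A ω')) |
          MeasurableSpace.comap H inferInstance] ω) := by
  have hp0 r a x : 0 < p r a x := hδ.trans_le (hpδ r a x)
  have hg0 h r a : 0 < g h r a := hδ.trans_le (hgδ h r a)
  have hp1 r a x : p r a x ≤ 1 := by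
    have h1 := hp0 true a x; have h2 := hp0 false a x; have h3 := hps a x
    cases r <;> linarith
  have hg1 h r a : g h r a ≤ 1 := by
    have h1 := hg0 h true a; have h2 := hg0 h false a; have h3 := hgs h a
    cases r <;> linarith
  have hpm : Measurable fun z : 𝓧 × Bool × 𝓐 => p z.2.1 z.2.2 z.1 := by
    have : Measurable fun z : Bool × 𝓐 × 𝓧 => p z.1 z.2.1 z.2.2 :=
      measurable_from_prod_countable_right hp
    exact this.comp (by fun_prop : Measurable fun z : 𝓧 × Bool × 𝓐 => (z.2.1, z.2.2, z.1))
  have hgm : Measurable fun z : 𝓗 × Bool × 𝓐 => g z.1 z.2.1 z.2.2 := by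
    have : Measurable fun z : Bool × 𝓗 × 𝓐 => g z.2.1 z.1 z.2.2 :=
      measurable_from_prod_countable_right hg
    exact this.comp (by fun_prop : Measurable fun z : 𝓗 × Bool × 𝓐 => (z.2.1, z.1, z.2.2))
  have hpu : Measurable (Function.uncurry fun (_ : 𝓗) (z : 𝓧 × Bool × 𝓐) =>
      ENNReal.ofReal (p z.2.1 z.2.2 z.1)) := (hpm.comp measurable_snd).ennreal_ofReal
  obtain ⟨κ, hκ⟩ : ∃ κ : Kernel 𝓗 (𝓧 × Bool × 𝓐), ∀ h,
      κ h = ((κX h).prod (Measure.count.prod (κA h))).withDensity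
        fun z => ENNReal.ofReal (p z.2.1 z.2.2 z.1) := by
    refine ⟨(κX ×ₖ (Kernel.const 𝓗 (Measure.count : Measure Bool) ×ₖ κA)).withDensity
      fun _ z => ENNReal.ofReal (p z.2.1 z.2.2 z.1), fun h => ?_⟩
    rw [Kernel.withDensity_apply _ hpu, Kernel.prod_apply, Kernel.prod_apply, Kernel.const_apply]
  have hbase (w : Bool → 𝓐 → ℝ) (hw : ∀ r, Measurable (w r)) (hw0 : ∀ r a, 0 < w r a)
      (hws : ∀ a, w true a + w false a = 1) (h : 𝓗) :
      ∫⁻ y, ENNReal.ofReal (w y.1 y.2) ∂((Measure.count : Measure Bool).prod (κA h)) = 1 := by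
    have hwm : Measurable fun y : Bool × 𝓐 => w y.1 y.2 := measurable_from_prod_countable_right hw
    rw [lintegral_prod _ hwm.ennreal_ofReal.aemeasurable, lintegral_count, tsum_bool,
      ← lintegral_add_left (hw false).ennreal_ofReal]
    simp_rw [← ENNReal.ofReal_add (hw0 _ _).le (hw0 _ _).le, add_comm (w false _), hws]
    simp
  have hpb h x : ∫⁻ y, ENNReal.ofReal (p y.1 y.2 x) ∂((Measure.count : Measure Bool).prod (κA h)) =
      1 := hbase (fun r a => p r a x) (fun r => (hp r).comp measurable_prodMk_right)
        (fun r a => hp0 r a x) (fun a => hps a x) h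
  have hgb h : ∫⁻ y, ENNReal.ofReal (g h y.1 y.2) ∂((Measure.count : Measure Bool).prod (κA h)) =
      1 := hbase (fun r a => g h r a) (fun r => (hg r).comp measurable_prodMk_left)
        (fun r a => hg0 h r a) (fun a => hgs h a) h
  have : IsMarkovKernel κ := ⟨fun h => ⟨by
    rw [hκ, withDensity_apply _ .univ, Measure.restrict_univ,
      lintegral_prod _ hpm.ennreal_ofReal.aemeasurable]
    simp [hpb]⟩⟩
  have hlaw := map_eq_compProd_withDensity μ hX hA hR hH κX κA hind
    (p := fun r a x => ENNReal.ofReal (p r a x))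
    (fun r => (hp r).ennreal_ofReal) hrew κ hκ
  have hY : Measurable fun ω => (X ω, R ω, A ω) := by fun_prop
  have hcd := ae_of_ae_map hH.aemeasurable
    (condDistrib_ae_eq_of_measure_eq_compProd H hY.aemeasurable hlaw)
  have hF : Measurable fun z : 𝓗 × 𝓧 × Bool × 𝓐 =>
      Real.log (p z.2.2.1 z.2.2.2 z.2.1 / g z.1 z.2.2.1 z.2.2.2) := by
    refine Real.measurable_log.comp ((hpm.comp measurable_snd).div ?_)
    exact hgm.comp (by fun_prop : Measurable fun z : 𝓗 × 𝓧 × Bool × 𝓐 => (z.1, z.2.2))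
  have hint : Integrable (fun ω => Real.log (p (R ω) (A ω) (X ω) / g (H ω) (R ω) (A ω))) μ := by
    refine Integrable.of_bound (C := -Real.log δ)
      (hF.comp (hH.prodMk hY)).aestronglyMeasurable (.of_forall fun ω => ?_)
    exact abs_log_div_le hδ (hpδ _ _ _) (hp1 _ _ _) (hgδ _ _ _) (hg1 _ _ _)
  refine ⟨hint, ?_⟩
  have hce := condExp_prod_ae_eq_integral_condDistrib hH hY.aemeasurable hF.stronglyMeasurable hint
  filter_upwards [hcd, hce] with ω h1 h2
  have key := klDiv_fst_prod_snd_le_integral_log (κX (H ω)) (Measure.count.prod (κA (H ω)))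
    hpm (hgm.comp measurable_prodMk_left : Measurable fun y : Bool × 𝓐 => g (H ω) y.1 y.2) hδ
    (fun z => hpδ _ _ _) (fun z => hp1 _ _ _) (fun y => hgδ _ _ _) (fun y => hg1 _ _ _)
    (hpb _) (hgb _) (hκ _)
  rw [h2, condMutualInfo, h1]
  exact key

/-! ### The logistic reward model -/

theorem logistic_pos (β x : ℝ) : 0 < logistic β x := by unfold logistic; positivity

theorem logistic_add_logistic_neg (β x : ℝ) : logistic β x + logistic β (-x) = 1 := by
  have h := Real.exp_pos (β * x)
  rw [logistic, logistic, mul_neg, Real.exp_neg]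
  field_simp
  ring

theorem logistic_mono {β : ℝ} (hβ : 0 < β) {x y : ℝ} (hxy : x ≤ y) :
    logistic β x ≤ logistic β y := by
  have h : Real.exp (β * x) ≤ Real.exp (β * y) := by gcongr
  have hx := Real.exp_pos (β * x)
  rw [logistic, logistic, div_le_div_iff₀ (by positivity) (by positivity)]
  linarith

theorem le_of_logistic_le {β : ℝ} (hβ : 0 < β) {x y : ℝ} (h : logistic β x ≤ logistic β y) :
    x ≤ y := by
  have hx := Real.exp_pos (β * x)
  have hy := Real.exp_pos (β * y)
  rw [logistic, logistic, div_le_div_iff₀ (by positivity) (by positivity)] at h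
  have h' : Real.exp (β * x) ≤ Real.exp (β * y) := by linarith
  exact le_of_mul_le_mul_left (Real.exp_le_exp.mp h') hβ

theorem measurable_logistic (β : ℝ) : Measurable (logistic β) := by
  unfold logistic; fun_prop

theorem logistic_le_exp_mul_logistic {β : ℝ} (hβ : 0 < β) (x y : ℝ) :
    logistic β x ≤ Real.exp (β * |x - y|) * logistic β y := by
  rcases le_total x y with h | h
  · refine (logistic_mono hβ h).trans (le_mul_of_one_le_left (logistic_pos β y).le ?_)
    exact Real.one_le_exp (by positivity)
  · have he : Real.exp (β * y) ≤ Real.exp (β * x) := by gcongr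
    rw [abs_of_nonneg (sub_nonneg.mpr h), logistic, logistic, ← mul_div_assoc, ← Real.exp_add,
      show β * (x - y) + β * y = β * x by ring]
    gcongr

/-- The probability of the reward `r` for the action `a` under the parameter `v`. The inner product
is clipped to `[-1, 1]`, which changes nothing in the unit ball and makes the probabilities bounded
below by `φ_β(-1)` for all `a` and `v`. For `r = false` the value `φ_β(-x) = 1 - φ_β(x)` is used. -/
noncomputable def rewardProb {d : ℕ} (β : ℝ) (r : Bool) (a v : EuclideanSpace ℝ (Fin d)) : ℝ :=
  logistic β ((if r then 1 else -1) * max (-1) (min 1 (inner ℝ a v)))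

section rewardProb

variable {d : ℕ} {β : ℝ}

theorem rewardProb_true_add_false (β : ℝ) (a v : EuclideanSpace ℝ (Fin d)) :
    rewardProb β true a v + rewardProb β false a v = 1 := by
  simp [rewardProb, logistic_add_logistic_neg]

theorem logistic_neg_one_le_rewardProb (hβ : 0 < β) (r : Bool) (a v : EuclideanSpace ℝ (Fin d)) :
    logistic β (-1) ≤ rewardProb β r a v := by
  refine logistic_mono hβ ?_
  have h1 : -1 ≤ max (-1) (min 1 (inner ℝ a v)) := le_max_left _ _
  have h2 : max (-1) (min 1 (inner ℝ a v)) ≤ 1 := max_le (by norm_num) (min_le_left _ _)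
  cases r <;> simp only [if_true, if_false, Bool.false_eq_true] <;> linarith

theorem rewardProb_pos (β : ℝ) (r : Bool) (a v : EuclideanSpace ℝ (Fin d)) :
    0 < rewardProb β r a v := logistic_pos _ _

theorem rewardProb_le_one (β : ℝ) (r : Bool) (a v : EuclideanSpace ℝ (Fin d)) :
    rewardProb β r a v ≤ 1 := by
  have h1 := rewardProb_pos β true a v
  have h2 := rewardProb_pos β false a v
  have h3 := rewardProb_true_add_false β a v
  cases r <;> linarith

theorem measurable_rewardProb (β : ℝ) :
    Measurable fun z : Bool × EuclideanSpace ℝ (Fin d) × EuclideanSpace ℝ (Fin d) =>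
      rewardProb β z.1 z.2.1 z.2.2 := by
  refine measurable_from_prod_countable_right fun r => (measurable_logistic β).comp ?_
  have : Measurable fun z : EuclideanSpace ℝ (Fin d) × EuclideanSpace ℝ (Fin d) =>
    (inner ℝ z.1 z.2 : ℝ) := measurable_fst.inner measurable_snd
  exact (measurable_const.max (measurable_const.min this)).const_mul (if r then 1 else -1)

theorem rewardProb_true_of_norm_le_one {a v : EuclideanSpace ℝ (Fin d)} (ha : ‖a‖ ≤ 1)
    (hv : ‖v‖ ≤ 1) : rewardProb β true a v = logistic β (inner ℝ a v) := by
  have h : |inner ℝ a v| ≤ 1 :=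
    (abs_real_inner_le_norm a v).trans (mul_le_one₀ ha (norm_nonneg v) hv)
  rw [rewardProb, min_eq_right (abs_le.mp h).2, max_eq_right (abs_le.mp h).1, if_pos rfl, one_mul]

theorem rewardProb_le_exp_mul (hβ : 0 < β) (r : Bool) {a v w : EuclideanSpace ℝ (Fin d)} {ε : ℝ}
    (ha : ‖a‖ ≤ 1) (hvw : dist v w ≤ ε) :
    rewardProb β r a v ≤ Real.exp (β * ε) * rewardProb β r a w := by
  refine (logistic_le_exp_mul_logistic hβ _
    ((if r then 1 else -1) * max (-1) (min 1 (inner ℝ a w)))).trans ?_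
  refine mul_le_mul_of_nonneg_right ?_ (logistic_pos _ _).le
  gcongr
  rw [← mul_sub, abs_mul]
  have h1 : |(if r then 1 else -1 : ℝ)| = 1 := by cases r <;> simp
  have h2 : |(inner ℝ a v : ℝ) - inner ℝ a w| ≤ ε := by
    rw [← inner_sub_right]
    refine (abs_real_inner_le_norm _ _).trans ?_
    rw [← dist_eq_norm]
    exact (mul_le_of_le_one_left dist_nonneg ha).trans hvw
  have h3 : 0 ≤ ε := dist_nonneg.trans hvw
  rw [h1, one_mul]
  refine (abs_max_sub_max_le_max _ _ _ _).trans (max_le (by simpa using h3) ?_)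
  exact (abs_min_sub_min_le_max _ _ _ _).trans (max_le (by simpa using h3) h2)

end rewardProb

/-! ### Likelihoods and the mixture forecaster -/

/-- The likelihood of the rewards of a history given its actions, under the parameter `v`. -/
noncomputable def likelihood {d : ℕ} (β : ℝ) {t : ℕ} (h : Fin t → EuclideanSpace ℝ (Fin d) × Bool)
    (v : EuclideanSpace ℝ (Fin d)) : ℝ :=
  ∏ s, rewardProb β (h s).2 (h s).1 v

/-- The likelihood of a history when the parameter is drawn from `ρ`. -/
noncomputable def mixtureLikelihood {d : ℕ} (β : ℝ) (ρ : Measure (EuclideanSpace ℝ (Fin d))) {t : ℕ}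
    (h : Fin t → EuclideanSpace ℝ (Fin d) × Bool) : ℝ :=
  ∫ v, likelihood β h v ∂ρ

/-- The Bayesian forecast, for the prior `ρ`, of the reward `r` of the action `a` after the
history `h`. -/
noncomputable def mixturePredictor {d : ℕ} (β : ℝ) (ρ : Measure (EuclideanSpace ℝ (Fin d))) {t : ℕ}
    (h : Fin t → EuclideanSpace ℝ (Fin d) × Bool) (r : Bool) (a : EuclideanSpace ℝ (Fin d)) : ℝ :=
  (∫ v, likelihood β h v * rewardProb β r a v ∂ρ) / mixtureLikelihood β ρ h

section likelihood

variable {d : ℕ} {β : ℝ} {t : ℕ}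

theorem likelihood_pos (β : ℝ) (h : Fin t → EuclideanSpace ℝ (Fin d) × Bool)
    (v : EuclideanSpace ℝ (Fin d)) : 0 < likelihood β h v :=
  Finset.prod_pos fun _ _ => rewardProb_pos _ _ _ _

theorem likelihood_le_one (β : ℝ) (h : Fin t → EuclideanSpace ℝ (Fin d) × Bool)
    (v : EuclideanSpace ℝ (Fin d)) : likelihood β h v ≤ 1 :=
  Finset.prod_le_one (fun _ _ => (rewardProb_pos _ _ _ _).le) fun _ _ => rewardProb_le_one _ _ _ _

theorem measurable_likelihood (β : ℝ) :
    Measurable fun z : (Fin t → EuclideanSpace ℝ (Fin d) × Bool) × EuclideanSpace ℝ (Fin d) =>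
      likelihood β z.1 z.2 := by
  refine Finset.measurable_prod _ fun s _ => ?_
  have : Measurable fun z : (Fin t → EuclideanSpace ℝ (Fin d) × Bool) × EuclideanSpace ℝ (Fin d) =>
      ((z.1 s).2, (z.1 s).1, z.2) := by fun_prop
  exact (measurable_rewardProb β).comp this

theorem likelihood_le_exp_mul (hβ : 0 < β) {h : Fin t → EuclideanSpace ℝ (Fin d) × Bool}
    (hh : ∀ s, ‖(h s).1‖ ≤ 1) {v w : EuclideanSpace ℝ (Fin d)} {ε : ℝ} (hvw : dist v w ≤ ε) :
    likelihood β h v ≤ Real.exp (ε * β * t) * likelihood β h w := by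
  calc likelihood β h v ≤ ∏ s : Fin t, Real.exp (β * ε) * rewardProb β (h s).2 (h s).1 w :=
        Finset.prod_le_prod (fun _ _ => (rewardProb_pos _ _ _ _).le)
          fun s _ => rewardProb_le_exp_mul hβ _ (hh s) hvw
    _ = Real.exp (ε * β * t) * likelihood β h w := by
        rw [Finset.prod_mul_distrib, Finset.prod_const, Finset.card_univ, Fintype.card_fin,
          ← Real.exp_nat_mul, likelihood]
        congr 2
        ring

variable (ρ : Measure (EuclideanSpace ℝ (Fin d))) [IsProbabilityMeasure ρ]

theorem integrable_likelihood (β : ℝ) (h : Fin t → EuclideanSpace ℝ (Fin d) × Bool) :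
    Integrable (likelihood β h) ρ := by
  refine Integrable.of_bound (C := 1)
    ((measurable_likelihood β).comp measurable_prodMk_left).aestronglyMeasurable
    (.of_forall fun v => ?_)
  rw [Real.norm_eq_abs, abs_of_pos (likelihood_pos β h v)]
  exact likelihood_le_one β h v

theorem integrable_likelihood_mul_rewardProb (β : ℝ)
    (h : Fin t → EuclideanSpace ℝ (Fin d) × Bool) (r : Bool) (a : EuclideanSpace ℝ (Fin d)) :
    Integrable (fun v => likelihood β h v * rewardProb β r a v) ρ := by
  refine (integrable_likelihood ρ β h).mul_bdd (c := 1) ?_ (.of_forall fun v => ?_)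
  · exact ((measurable_rewardProb β).comp (measurable_prodMk_left.comp
      measurable_prodMk_left : Measurable fun v => (r, a, v))).aestronglyMeasurable
  · rw [Real.norm_eq_abs, abs_of_pos (rewardProb_pos β r a v)]
    exact rewardProb_le_one β r a v

theorem mixtureLikelihood_pos (β : ℝ) (h : Fin t → EuclideanSpace ℝ (Fin d) × Bool) :
    0 < mixtureLikelihood β ρ h := by
  refine (integral_pos_iff_support_of_nonneg (fun v => (likelihood_pos β h v).le)
    (integrable_likelihood ρ β h)).mpr ?_
  have : Function.support (likelihood β h) = Set.univ :=
    Set.eq_univ_of_forall fun v => (likelihood_pos β h v).ne'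
  simp [this]

theorem mixturePredictor_true_add_false (β : ℝ) (h : Fin t → EuclideanSpace ℝ (Fin d) × Bool)
    (a : EuclideanSpace ℝ (Fin d)) :
    mixturePredictor β ρ h true a + mixturePredictor β ρ h false a = 1 := by
  rw [mixturePredictor, mixturePredictor, ← add_div, ← integral_add
    (integrable_likelihood_mul_rewardProb ρ β h _ a)
    (integrable_likelihood_mul_rewardProb ρ β h _ a)]
  simp_rw [← mul_add, rewardProb_true_add_false, mul_one]
  exact div_self (mixtureLikelihood_pos ρ β h).ne'

theorem logistic_neg_one_le_mixturePredictor (hβ : 0 < β)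
    (h : Fin t → EuclideanSpace ℝ (Fin d) × Bool) (r : Bool) (a : EuclideanSpace ℝ (Fin d)) :
    logistic β (-1) ≤ mixturePredictor β ρ h r a := by
  rw [mixturePredictor, le_div_iff₀ (mixtureLikelihood_pos ρ β h), mul_comm, mixtureLikelihood,
    ← integral_mul_const]
  refine integral_mono ((integrable_likelihood ρ β h).mul_const _)
    (integrable_likelihood_mul_rewardProb ρ β h r a) fun v => ?_
  exact mul_le_mul_of_nonneg_left (logistic_neg_one_le_rewardProb hβ r a v)
    (likelihood_pos β h v).le

theorem measurable_mixturePredictor (β : ℝ) (r : Bool) :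
    Measurable fun z : (Fin t → EuclideanSpace ℝ (Fin d) × Bool) × EuclideanSpace ℝ (Fin d) =>
      mixturePredictor β ρ z.1 r z.2 := by
  refine Measurable.div ?_ ?_
  · refine (StronglyMeasurable.integral_prod_right'
      (f := fun z : ((Fin t → EuclideanSpace ℝ (Fin d) × Bool) × EuclideanSpace ℝ (Fin d)) ×
        EuclideanSpace ℝ (Fin d) => likelihood β z.1.1 z.2 * rewardProb β r z.1.2 z.2)
      (Measurable.stronglyMeasurable ?_)).measurable
    refine ((measurable_likelihood β).comp (f := fun z : ((Fin t → EuclideanSpace ℝ (Fin d) × Bool)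
        × EuclideanSpace ℝ (Fin d)) × EuclideanSpace ℝ (Fin d) => (z.1.1, z.2)) (by fun_prop)).mul
      ((measurable_rewardProb β).comp (f := fun z : ((Fin t → EuclideanSpace ℝ (Fin d) × Bool)
        × EuclideanSpace ℝ (Fin d)) × EuclideanSpace ℝ (Fin d) => (r, z.1.2, z.2)) (by fun_prop))
  · refine Measurable.comp (g := fun h => mixtureLikelihood β ρ h) ?_ measurable_fst
    exact (measurable_likelihood β).stronglyMeasurable.integral_prod_right'.measurable

/-- A mixture likelihood dominates the contribution of each atom of the prior. -/
theorem measureReal_singleton_mul_likelihood_le (β : ℝ)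
    (h : Fin t → EuclideanSpace ℝ (Fin d) × Bool) (v : EuclideanSpace ℝ (Fin d)) :
    ρ.real {v} * likelihood β h v ≤ mixtureLikelihood β ρ h := by
  calc ρ.real {v} * likelihood β h v = ∫ w in {v}, likelihood β h w ∂ρ := by
        rw [integral_singleton, smul_eq_mul]
    _ ≤ mixtureLikelihood β ρ h := setIntegral_le_integral (integrable_likelihood ρ β h)
        (.of_forall fun w => (likelihood_pos β h w).le)

/-- The mixture does almost as well as the parameter `v`, provided that its prior has an atom `w`
close to `v`. -/
theorem log_likelihood_div_mixtureLikelihood_le (hβ : 0 < β)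
    {h : Fin t → EuclideanSpace ℝ (Fin d) × Bool} (hh : ∀ s, ‖(h s).1‖ ≤ 1)
    {v w : EuclideanSpace ℝ (Fin d)} {ε : ℝ} (hvw : dist v w ≤ ε) (hw : 0 < ρ.real {w}) :
    Real.log (likelihood β h v / mixtureLikelihood β ρ h) ≤
      -Real.log (ρ.real {w}) + ε * β * t := by
  have h1 := Real.log_le_log (likelihood_pos β h v) (likelihood_le_exp_mul hβ hh hvw)
  have h2 := Real.log_le_log (mul_pos hw (likelihood_pos β h w))
    (measureReal_singleton_mul_likelihood_le ρ β h w)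
  rw [Real.log_mul (Real.exp_pos _).ne' (likelihood_pos β h w).ne', Real.log_exp] at h1
  rw [Real.log_mul hw.ne' (likelihood_pos β h w).ne'] at h2
  rw [Real.log_div (likelihood_pos β h v).ne' (mixtureLikelihood_pos ρ β h).ne']
  linarith

/-- The log-losses telescope, as the forecast of the mixture is the ratio of the mixture
likelihoods of two successive histories. -/
theorem sum_log_rewardProb_div_mixturePredictor {Ω : Type*}
    (π : EuclideanSpace ℝ (Fin d) → EuclideanSpace ℝ (Fin d))
    (Θhat : ℕ → Ω → EuclideanSpace ℝ (Fin d)) (R : ℕ → Ω → Bool) (ω : Ω)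
    (v : EuclideanSpace ℝ (Fin d)) (n : ℕ) :
    ∑ t ∈ Finset.range n, Real.log (rewardProb β (R t ω) (π (Θhat t ω)) v /
        mixturePredictor β ρ (history π Θhat R t ω) (R t ω) (π (Θhat t ω))) =
      Real.log (likelihood β (history π Θhat R n ω) v /
        mixtureLikelihood β ρ (history π Θhat R n ω)) := by
  have hsucc n w : likelihood β (history π Θhat R (n + 1) ω) w =
      likelihood β (history π Θhat R n ω) w * rewardProb β (R n ω) (π (Θhat n ω)) w := by
    rw [likelihood, Fin.prod_univ_castSucc]
    rfl
  induction n with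
  | zero => simp [likelihood, mixtureLikelihood]
  | succ n ih =>
    have h1 := (likelihood_pos β (history π Θhat R n ω) v).ne'
    have h2 := (rewardProb_pos β (R n ω) (π (Θhat n ω)) v).ne'
    have h3 := (mixtureLikelihood_pos ρ β (history π Θhat R n ω)).ne'
    have h4 : mixtureLikelihood β ρ (history π Θhat R (n + 1) ω) ≠ 0 :=
      (mixtureLikelihood_pos ρ β _).ne'
    have hm : ∫ w, likelihood β (history π Θhat R n ω) w *
        rewardProb β (R n ω) (π (Θhat n ω)) w ∂ρ =
        mixtureLikelihood β ρ (history π Θhat R (n + 1) ω) := by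
      simp_rw [mixtureLikelihood, hsucc]
    rw [Finset.sum_range_succ, ih, mixturePredictor, hm, hsucc, ← Real.log_mul
      (div_ne_zero h1 h3) (div_ne_zero h2 (div_ne_zero h4 h3))]
    congr 1
    field_simp

end likelihood

/-! ### Entropy of a discrete random variable -/

theorem ae_measureReal_preimage_singleton_pos {Ω 𝓧 : Type*} [MeasurableSpace Ω] {μ : Measure Ω}
    [IsFiniteMeasure μ] {X : Ω → 𝓧} {S : Set 𝓧} (hS : S.Countable) (hXS : ∀ᵐ ω ∂μ, X ω ∈ S) :
    ∀ᵐ ω ∂μ, 0 < μ.real (X ⁻¹' {X ω}) := by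
  have h : ∀ᵐ ω ∂μ, ∀ x ∈ S, μ (X ⁻¹' {x}) = 0 → X ω ≠ x := by
    rw [ae_ball_iff hS]
    intro x _
    by_cases hx : μ (X ⁻¹' {x}) = 0
    · filter_upwards [measure_eq_zero_iff_ae_notMem.mp hx] with ω hω _ using hω
    · exact .of_forall fun ω h => absurd h hx
  filter_upwards [h, hXS] with ω h1 h2
  exact ENNReal.toReal_pos (fun h0 => h1 _ h2 h0 rfl) (measure_ne_top _ _)

theorem lintegral_neg_log_measureReal_le_entropy {Ω 𝓧 : Type*} [MeasurableSpace Ω]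
    [MeasurableSpace 𝓧] [MeasurableSingletonClass 𝓧] {μ : Measure Ω} [IsProbabilityMeasure μ]
    {X : Ω → 𝓧} (hX : Measurable X) {S : Set 𝓧} (hS : S.Countable) (hXS : ∀ᵐ ω ∂μ, X ω ∈ S) :
    ∫⁻ ω, ENNReal.ofReal (-Real.log (μ.real (X ⁻¹' {X ω}))) ∂μ ≤ entropy μ X := by
  rw [entropy, if_pos ⟨S, hS, hXS⟩]
  have : Countable S := hS.to_subtype
  calc ∫⁻ ω, ENNReal.ofReal (-Real.log (μ.real (X ⁻¹' {X ω}))) ∂μ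
      = ∫⁻ ω in ⋃ x : S, X ⁻¹' {(x : 𝓧)}, ENNReal.ofReal (-Real.log (μ.real (X ⁻¹' {X ω}))) ∂μ := by
        rw [Measure.restrict_eq_self_of_ae_mem (hXS.mono fun ω hω =>
          Set.mem_iUnion.mpr ⟨⟨X ω, hω⟩, rfl⟩)]
    _ ≤ ∑' x : S, ∫⁻ ω in X ⁻¹' {(x : 𝓧)},
          ENNReal.ofReal (-Real.log (μ.real (X ⁻¹' {X ω}))) ∂μ := lintegral_iUnion_le _ _
    _ = ∑' x : S, ENNReal.ofReal (Real.negMulLog (μ.real (X ⁻¹' {(x : 𝓧)}))) := by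
        refine tsum_congr fun x => ?_
        rw [setLIntegral_congr_fun (g := fun _ =>
          ENNReal.ofReal (-Real.log (μ.real (X ⁻¹' {(x : 𝓧)})))) (hX (measurableSet_singleton _))
          fun ω hω => by rw [Set.mem_preimage, Set.mem_singleton_iff] at hω; simp only [hω],
          setLIntegral_const, ← ofReal_measureReal, ← ENNReal.ofReal_mul' measureReal_nonneg]
        rw [Real.negMulLog, neg_mul_comm, mul_comm]
    _ ≤ _ := ENNReal.tsum_comp_le_tsum_of_injective Subtype.val_injective _

/-! ### Conditional independence and the Cauchy-Schwarz inequality -/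

/-- If `Y` is drawn, given `(X, H)`, from the conditional law of `X` given `H`, then `X` and `Y` are
independent and identically distributed given `H`; so are their images under `f`. -/
theorem map_eq_compProd_prod_of_condExp {Ω 𝓧 𝓐 𝓗 : Type*} [MeasurableSpace Ω] [MeasurableSpace 𝓧]
    [MeasurableSpace 𝓐] [MeasurableSpace 𝓗] [StandardBorelSpace 𝓧] [Nonempty 𝓧]
    (μ : Measure Ω) [IsProbabilityMeasure μ] {X Y : Ω → 𝓧} {H : Ω → 𝓗}
    (hX : Measurable X) (hY : Measurable Y) (hH : Measurable H)
    (h : ∀ B, MeasurableSet B →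
      μ⟦Y ⁻¹' B | MeasurableSpace.comap (fun ω => (X ω, H ω)) inferInstance⟧ =ᵐ[μ]
        μ⟦X ⁻¹' B | MeasurableSpace.comap H inferInstance⟧)
    {f : 𝓧 → 𝓐} (hf : Measurable f) :
    μ.map (fun ω => (H ω, f (X ω), f (Y ω))) =
      μ.map H ⊗ₘ ((condDistrib X H μ).map f ×ₖ (condDistrib X H μ).map f) := by
  have hXH : Measurable fun ω => (X ω, H ω) := hX.prodMk hH
  have hlaw : μ.map (fun ω => ((X ω, H ω), Y ω)) =
      μ.map (fun ω => (X ω, H ω)) ⊗ₘ (condDistrib X H μ).prodMkLeft 𝓧 := by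
    refine map_prodMk_eq_compProd_of_condExp μ hXH hY _ fun B hB => (h B hB).trans ?_
    exact (condDistrib_ae_eq_condExp hH hX hB).symm
  refine Measure.ext_of_lintegral _ fun F hF => ?_
  have h1 : Measurable fun z : (𝓧 × 𝓗) × 𝓧 => F (z.1.2, f z.1.1, f z.2) := by fun_prop
  have h2 : Measurable fun z : 𝓧 × 𝓗 => ∫⁻ y, F (z.2, f z.1, f y) ∂(condDistrib X H μ z.2) :=
    Measurable.lintegral_kernel_prod_right' (κ := (condDistrib X H μ).prodMkLeft 𝓧) h1
  have h3 : Measurable fun z : 𝓗 × 𝓧 => ∫⁻ y, F (z.1, f z.2, f y) ∂(condDistrib X H μ z.1) :=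
    h2.comp measurable_swap
  calc ∫⁻ z, F z ∂(μ.map (fun ω => (H ω, f (X ω), f (Y ω))))
      = ∫⁻ z, F (z.1.2, f z.1.1, f z.2) ∂(μ.map (fun ω => ((X ω, H ω), Y ω))) := by
        rw [lintegral_map hF (by fun_prop), lintegral_map h1 (by fun_prop)]
    _ = ∫⁻ ω, ∫⁻ y, F (H ω, f (X ω), f y) ∂(condDistrib X H μ (H ω)) ∂μ := by
        rw [hlaw, Measure.lintegral_compProd h1]
        simp only [Kernel.prodMkLeft_apply]
        rw [lintegral_map h2 hXH]
    _ = ∫⁻ z, ∫⁻ y, F (z.1, f z.2, f y) ∂(condDistrib X H μ z.1)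
          ∂(μ.map (fun ω => (H ω, X ω))) := by
        rw [lintegral_map h3 (hH.prodMk hX)]
    _ = _ := by
        rw [← compProd_map_condDistrib hX.aemeasurable,
          Measure.lintegral_compProd h3, Measure.lintegral_compProd hF]
        refine lintegral_congr fun h => ?_
        rw [Kernel.prod_apply, lintegral_prod _ (by fun_prop), Kernel.map_apply _ hf,
          lintegral_map ?_ hf]
        · refine lintegral_congr fun x => ?_
          rw [lintegral_map (by fun_prop) hf]
        · refine Measurable.lintegral_prod_right' (f := fun z : 𝓐 × 𝓐 => F (h, z.1, z.2)) ?_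
          fun_prop

/-- The Cauchy-Schwarz inequality for `|D| = (D² / J)^(1/2) J^(1/2)`. No measurability of the upper
bound `G` of the ratio is needed, as `D² / J` is measurable. -/
theorem ofReal_integral_le_of_sq_div_le {Ω : Type*} [MeasurableSpace Ω] {μ : Measure Ω}
    {D J : Ω → ℝ} (hD : AEMeasurable D μ) (hJ : AEMeasurable J μ) {G : Ω → ℝ≥0∞}
    (hG : ∀ᵐ ω ∂μ, ENNReal.ofReal (D ω ^ 2) / ENNReal.ofReal (J ω) ≤ G ω)
    (hGtop : ∫⁻ ω, G ω ∂μ ≠ ∞) :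
    ENNReal.ofReal (∫ ω, D ω ∂μ) ≤
      (∫⁻ ω, G ω ∂μ) ^ (1 / 2 : ℝ) * (∫⁻ ω, ENNReal.ofReal (J ω) ∂μ) ^ (1 / 2 : ℝ) := by
  set V : Ω → ℝ≥0∞ := fun ω => ENNReal.ofReal (D ω ^ 2) / ENNReal.ofReal (J ω) with hV
  have hVm : AEMeasurable V μ := (hD.pow_const 2).ennreal_ofReal.div hJ.ennreal_ofReal
  have hVG : ∫⁻ ω, V ω ∂μ ≤ ∫⁻ ω, G ω ∂μ := lintegral_mono_ae hG
  have hfin := ae_lt_top' hVm (hVG.trans_lt hGtop.lt_top).ne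
  have hroot (x : ℝ≥0∞) : (x ^ (1 / 2 : ℝ)) ^ (2 : ℝ) = x := by
    rw [← ENNReal.rpow_mul]; norm_num
  calc ENNReal.ofReal (∫ ω, D ω ∂μ)
      ≤ ‖∫ ω, D ω ∂μ‖ₑ := Real.ofReal_le_enorm _
    _ ≤ ∫⁻ ω, ‖D ω‖ₑ ∂μ := enorm_integral_le_lintegral_enorm _
    _ = ∫⁻ ω, ((fun ω => V ω ^ (1 / 2 : ℝ)) * fun ω => ENNReal.ofReal (J ω) ^ (1 / 2 : ℝ)) ω ∂μ := by
        refine lintegral_congr_ae ?_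
        filter_upwards [hfin] with ω hω
        have hcancel : V ω * ENNReal.ofReal (J ω) = ENNReal.ofReal (D ω ^ 2) := by
          -- The quotient is `∞` where `J ω = 0 < D ω ^ 2`, so finiteness excludes that case.
          refine ENNReal.div_mul_cancel' (fun h0 => ?_) (fun h => absurd h ENNReal.ofReal_ne_top)
          by_contra hne
          simp only [hV, h0, ENNReal.div_zero hne, lt_self_iff_false] at hω
        rw [Pi.mul_apply, ← ENNReal.mul_rpow_of_nonneg _ _ (by norm_num), hcancel,
          ← sq_abs, ENNReal.ofReal_pow (abs_nonneg _), ← Real.norm_eq_abs, ofReal_norm,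
          ← ENNReal.rpow_natCast, ← ENNReal.rpow_mul]
        norm_num
    _ ≤ (∫⁻ ω, (V ω ^ (1 / 2 : ℝ)) ^ (2 : ℝ) ∂μ) ^ (1 / 2 : ℝ) *
          (∫⁻ ω, (ENNReal.ofReal (J ω) ^ (1 / 2 : ℝ)) ^ (2 : ℝ) ∂μ) ^ (1 / 2 : ℝ) :=
        ENNReal.lintegral_mul_le_Lp_mul_Lq μ Real.HolderConjugate.two_two (hVm.pow_const _)
          (hJ.ennreal_ofReal.pow_const _)
    _ ≤ _ := by
        simp_rw [hroot]
        gcongr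

theorem sum_rpow_half_mul_le {ι : Type*} (s : Finset ι) (a b : ι → ℝ≥0∞) :
    ∑ i ∈ s, a i ^ (1 / 2 : ℝ) * b i ^ (1 / 2 : ℝ) ≤
      ((∑ i ∈ s, a i) * ∑ i ∈ s, b i) ^ (1 / 2 : ℝ) := by
  have hroot (x : ℝ≥0∞) : (x ^ (1 / 2 : ℝ)) ^ (2 : ℝ) = x := by
    rw [← ENNReal.rpow_mul]; norm_num
  have h := ENNReal.inner_le_Lp_mul_Lq s (fun i => a i ^ (1 / 2 : ℝ)) (fun i => b i ^ (1 / 2 : ℝ))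
    Real.HolderConjugate.two_two
  simp only [hroot] at h
  rwa [ENNReal.mul_rpow_of_nonneg _ _ (by norm_num)]

/-! ### Thompson Sampling -/

/-- The parameter is the unique maximizer: `⟪π θ, θ⟫ ≥ ⟪θ, θ⟫ = 1` with `‖π θ‖ ≤ 1`. -/
theorem IsOptimalMapping.apply_eq_self {d : ℕ} {β : ℝ} (hβ : 0 < β)
    {A O : Set (EuclideanSpace ℝ (Fin d))} (hA : A ⊆ Metric.closedBall 0 1)
    (hO : O ⊆ Metric.sphere 0 1) (hOA : O ⊆ A)
    {π : EuclideanSpace ℝ (Fin d) → EuclideanSpace ℝ (Fin d)} (hπ : IsOptimalMapping β A O π)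
    {θ : EuclideanSpace ℝ (Fin d)} (hθ : θ ∈ O) : π θ = θ := by
  have h1 : ‖θ‖ = 1 := by simpa using hO hθ
  have h2 : ‖π θ‖ ≤ 1 := by simpa using hA (hπ θ hθ).1
  have h3 := le_of_logistic_le hβ ((hπ θ hθ).2 θ (hOA hθ))
  rw [real_inner_self_eq_norm_sq, h1] at h3
  have h4 := norm_sub_sq_real (π θ) θ
  have h5 : ‖π θ - θ‖ ^ 2 ≤ 0 := by nlinarith [norm_nonneg (π θ)]
  exact sub_eq_zero.mp (norm_eq_zero.mp (pow_eq_zero_iff two_ne_zero |>.mp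
    (le_antisymm h5 (sq_nonneg _))))

section ThompsonSampling

variable {Ω : Type*} [MeasurableSpace Ω] {μ : Measure Ω} [IsProbabilityMeasure μ] {d : ℕ} {β : ℝ}
  {π : EuclideanSpace ℝ (Fin d) → EuclideanSpace ℝ (Fin d)} {T : ℕ}
  {Θ : Ω → EuclideanSpace ℝ (Fin d)} {Θhat : ℕ → Ω → EuclideanSpace ℝ (Fin d)}
  {R Ropt : ℕ → Ω → Bool}

omit [IsProbabilityMeasure μ] in
theorem IsThompsonSampling.measurable_history (hTS : IsThompsonSampling μ β π T Θ Θhat R Ropt)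
    (hπm : Measurable π) (t : ℕ) : Measurable (history π Θhat R t) :=
  measurable_pi_lambda _ fun s =>
    (hπm.comp (hTS.measurable_estimate s)).prodMk (hTS.measurable_reward s)

/-- The estimate of a round has the same law as the parameter, by integrating `sampling`. -/
theorem IsThompsonSampling.ae_estimate_mem (hTS : IsThompsonSampling μ β π T Θ Θhat R Ropt)
    (hπm : Measurable π) {S : Set (EuclideanSpace ℝ (Fin d))} (hS : MeasurableSet S)
    (hΘ : ∀ᵐ ω ∂μ, Θ ω ∈ S) {t : ℕ} (ht : t < T) : ∀ᵐ ω ∂μ, Θhat t ω ∈ S := by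
  have hH := hTS.measurable_history hπm t
  have hm := (hTS.measurable_param.prodMk hH).comap_le
  have hreal : μ.real (Θhat t ⁻¹' S) = μ.real (Θ ⁻¹' S) := by
    have h := integral_congr_ae (hTS.sampling t ht S hS)
    rw [integral_condExp hm, integral_condExp hH.comap_le,
      integral_indicator (hTS.measurable_estimate t hS),
      integral_indicator (hTS.measurable_param hS)] at h
    simpa using h
  have h1 : μ (Θ ⁻¹' S) = 1 := (mem_ae_iff_prob_eq_one (hTS.measurable_param hS)).mp hΘ
  refine (mem_ae_iff_prob_eq_one (hTS.measurable_estimate t hS)).mpr ?_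
  rw [← ofReal_measureReal, hreal, measureReal_def, h1, ENNReal.toReal_one, ENNReal.ofReal_one]

/-- Integrated form of the reward model: given the history, the optimal action and the action of
the round, the reward is `r` with probability `rewardProb β r`. -/
theorem IsThompsonSampling.measure_inter_reward (hTS : IsThompsonSampling μ β π T Θ Θhat R Ropt)
    (hπm : Measurable π) {t : ℕ} (ht : t < T) (hfix : ∀ᵐ ω ∂μ, π (Θ ω) = Θ ω)
    (hΘ : ∀ᵐ ω ∂μ, ‖Θ ω‖ ≤ 1) (ha : ∀ᵐ ω ∂μ, ‖π (Θhat t ω)‖ ≤ 1) (r : Bool)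
    (S : Set ((Fin t → EuclideanSpace ℝ (Fin d) × Bool) × EuclideanSpace ℝ (Fin d) ×
      EuclideanSpace ℝ (Fin d))) (hS : MeasurableSet S) :
    μ ((fun ω => (history π Θhat R t ω, π (Θ ω), π (Θhat t ω))) ⁻¹' S ∩ R t ⁻¹' {r}) =
      ∫⁻ ω in (fun ω => (history π Θhat R t ω, π (Θ ω), π (Θhat t ω))) ⁻¹' S,
        ENNReal.ofReal (rewardProb β r (π (Θhat t ω)) (π (Θ ω))) ∂μ := by
  have hH := hTS.measurable_history hπm t
  have hΘm := hTS.measurable_param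
  have hAm := hπm.comp (hTS.measurable_estimate t)
  have hZ : Measurable fun ω => (Θ ω, history π Θhat R t ω, π (Θhat t ω)) :=
    hΘm.prodMk (hH.prodMk hAm)
  set U := (fun ω => (history π Θhat R t ω, π (Θ ω), π (Θhat t ω))) ⁻¹' S with hU
  have hUZ : MeasurableSet[MeasurableSpace.comap
      (fun ω => (Θ ω, history π Θhat R t ω, π (Θhat t ω))) inferInstance] U :=
    ⟨(fun z => (z.2.1, π z.1, z.2.2)) ⁻¹' S, (by fun_prop : Measurable _) hS, rfl⟩
  have hUm : MeasurableSet U := hZ.comap_le _ hUZ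
  have hR b : MeasurableSet (R t ⁻¹' {b}) := hTS.measurable_reward t (measurableSet_singleton b)
  have hval : (fun ω => rewardValue (R t ω)) = (R t ⁻¹' {true}).indicator fun _ => (1 : ℝ) := by
    ext ω
    by_cases h : R t ω = true <;> simp [rewardValue, h]
  have hint : Integrable (fun ω => rewardValue (R t ω)) μ := by
    rw [hval]; exact (integrable_const 1).indicator (hR true)
  have hpint b : Integrable (fun ω => rewardProb β b (π (Θhat t ω)) (π (Θ ω))) μ := by
    refine Integrable.of_bound (C := 1) ((measurable_rewardProb β).comp
      (measurable_const.prodMk (hAm.prodMk (hπm.comp hΘm)))).aestronglyMeasurable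
      (.of_forall fun ω => ?_)
    rw [Real.norm_eq_abs, abs_of_pos (rewardProb_pos _ _ _ _)]
    exact rewardProb_le_one _ _ _ _
  have htrue : μ.real (U ∩ R t ⁻¹' {true}) =
      ∫ ω in U, rewardProb β true (π (Θhat t ω)) (π (Θ ω)) ∂μ := by
    have h1 := setIntegral_condExp hZ.comap_le hint hUZ
    rw [hval, setIntegral_indicator (hR true), setIntegral_const, smul_eq_mul, mul_one,
      ← hval] at h1
    rw [← h1]
    refine setIntegral_congr_ae hUm ?_
    filter_upwards [hTS.reward t ht, hfix, hΘ, ha] with ω h2 h3 h4 h5 _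
    rw [h2, h3, rewardProb_true_of_norm_le_one h5 h4]
  have hreal : μ.real (U ∩ R t ⁻¹' {r}) =
      ∫ ω in U, rewardProb β r (π (Θhat t ω)) (π (Θ ω)) ∂μ := by
    cases r with
    | true => exact htrue
    | false =>
      have hc : U ∩ R t ⁻¹' {false} = U \ (R t ⁻¹' {true}) := by
        ext ω; simp
      have h1 : ∀ ω, rewardProb β false (π (Θhat t ω)) (π (Θ ω)) =
          1 - rewardProb β true (π (Θhat t ω)) (π (Θ ω)) := fun ω => by
        linarith [rewardProb_true_add_false β (π (Θhat t ω)) (π (Θ ω))]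
      have h2 := measureReal_inter_add_sdiff (μ := μ) (s := U) (hR true)
      simp_rw [h1]
      rw [integral_sub (integrable_const 1) (hpint true).integrableOn, ← htrue, hc,
        setIntegral_const, smul_eq_mul, mul_one]
      linarith
  rw [← ofReal_measureReal, hreal, ofReal_integral_eq_lintegral_ofReal (hpint r).integrableOn
    (.of_forall fun ω => (rewardProb_pos _ _ _ _).le)]

/-- The log-loss in round `t` of the mixture forecaster with prior `ρ`, in excess over that of the
forecaster that knows the optimal action `π Θ` (which is the parameter itself). -/
noncomputable def excessLogLoss {Ω : Type*} {d : ℕ} (β : ℝ)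
    (ρ : Measure (EuclideanSpace ℝ (Fin d)))
    (π : EuclideanSpace ℝ (Fin d) → EuclideanSpace ℝ (Fin d))
    (Θ : Ω → EuclideanSpace ℝ (Fin d)) (Θhat : ℕ → Ω → EuclideanSpace ℝ (Fin d))
    (R : ℕ → Ω → Bool) (t : ℕ) (ω : Ω) : ℝ :=
  Real.log (rewardProb β (R t ω) (π (Θhat t ω)) (π (Θ ω)) /
    mixturePredictor β ρ (history π Θhat R t ω) (R t ω) (π (Θhat t ω)))

omit [MeasurableSpace Ω] in
theorem sum_excessLogLoss (ρ : Measure (EuclideanSpace ℝ (Fin d))) [IsProbabilityMeasure ρ]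
    (ω : Ω) (n : ℕ) :
    ∑ t ∈ Finset.range n, excessLogLoss β ρ π Θ Θhat R t ω =
      Real.log (likelihood β (history π Θhat R n ω) (π (Θ ω)) /
        mixtureLikelihood β ρ (history π Θhat R n ω)) := by
  simp only [excessLogLoss]
  exact sum_log_rewardProb_div_mixturePredictor ρ π Θhat R ω (π (Θ ω)) n

theorem IsThompsonSampling.condMutualInfo_le (hTS : IsThompsonSampling μ β π T Θ Θhat R Ropt)
    (hβ : 0 < β) (hπm : Measurable π) {t : ℕ} (ht : t < T) (hfix : ∀ᵐ ω ∂μ, π (Θ ω) = Θ ω)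
    (hΘ : ∀ᵐ ω ∂μ, ‖Θ ω‖ ≤ 1) (ha : ∀ᵐ ω ∂μ, ‖π (Θhat t ω)‖ ≤ 1)
    (ρ : Measure (EuclideanSpace ℝ (Fin d))) [IsProbabilityMeasure ρ] :
    Integrable (excessLogLoss β ρ π Θ Θhat R t) μ ∧ ∀ᵐ ω ∂μ,
      0 ≤ μ[excessLogLoss β ρ π Θ Θhat R t |
          MeasurableSpace.comap (history π Θhat R t) inferInstance] ω ∧
      condMutualInfo μ (fun ω' => π (Θ ω')) (fun ω' => (R t ω', π (Θhat t ω')))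
        (history π Θhat R t) ω ≤ ENNReal.ofReal (μ[excessLogLoss β ρ π Θ Θhat R t |
          MeasurableSpace.comap (history π Θhat R t) inferInstance] ω) := by
  have hH := hTS.measurable_history hπm t
  have hind := map_eq_compProd_prod_of_condExp μ hTS.measurable_param (hTS.measurable_estimate t)
    hH (hTS.sampling t ht) hπm
  have : IsMarkovKernel ((condDistrib Θ (history π Θhat R t) μ).map π) :=
    Kernel.IsMarkovKernel.map _ hπm
  exact condMutualInfo_le_condExp_log μ (hπm.comp hTS.measurable_param)
    (hπm.comp (hTS.measurable_estimate t)) (hTS.measurable_reward t) hH _ _ hind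
    (p := rewardProb β) (g := mixturePredictor β ρ)
    (fun r => (measurable_rewardProb β).comp measurable_prodMk_left)
    (hTS.measure_inter_reward hπm ht hfix hΘ ha)
    (measurable_mixturePredictor ρ β) (logistic_pos β (-1))
    (logistic_neg_one_le_rewardProb hβ) (rewardProb_true_add_false β)
    (logistic_neg_one_le_mixturePredictor ρ hβ) (mixturePredictor_true_add_false ρ β)

/-- The expected excess log-losses of the mixture over the law of `q(Θ)`, and hence the expected
informations gained about the optimal action, sum to at most `H(q(Θ)) + ε β T`. -/
theorem IsThompsonSampling.sum_lintegral_condExp_excessLogLoss_le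
    (hTS : IsThompsonSampling μ β π T Θ Θhat R Ropt) (hβ : 0 < β) (hπm : Measurable π)
    (hfix : ∀ᵐ ω ∂μ, π (Θ ω) = Θ ω) (hΘ : ∀ᵐ ω ∂μ, ‖Θ ω‖ ≤ 1)
    (ha : ∀ t < T, ∀ᵐ ω ∂μ, ‖π (Θhat t ω)‖ ≤ 1)
    {q : EuclideanSpace ℝ (Fin d) → EuclideanSpace ℝ (Fin d)} (hq : Measurable q) {ε : ℝ}
    (hε : 0 < ε) (hdist : ∀ᵐ ω ∂μ, dist (Θ ω) (q (Θ ω)) ≤ ε)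
    {S : Set (EuclideanSpace ℝ (Fin d))} (hS : S.Countable) (hqS : ∀ᵐ ω ∂μ, q (Θ ω) ∈ S) :
    ∑ t ∈ Finset.range T, ∫⁻ ω, ENNReal.ofReal
        (μ[excessLogLoss β (μ.map fun ω => q (Θ ω)) π Θ Θhat R t |
          MeasurableSpace.comap (history π Θhat R t) inferInstance] ω) ∂μ ≤
      entropy μ (fun ω => q (Θ ω)) + ENNReal.ofReal (ε * β * T) := by
  have hqΘ : Measurable fun ω => q (Θ ω) := hq.comp hTS.measurable_param
  set ρ := μ.map fun ω => q (Θ ω)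
  have : IsProbabilityMeasure ρ := Measure.isProbabilityMeasure_map hqΘ.aemeasurable
  have hHm t := (hTS.measurable_history hπm t).comap_le
  have hI t (ht : t ∈ Finset.range T) := hTS.condMutualInfo_le hβ hπm (Finset.mem_range.mp ht) hfix
    hΘ (ha t (Finset.mem_range.mp ht)) ρ
  have hnn t (ht : t ∈ Finset.range T) : 0 ≤ᵐ[μ] μ[excessLogLoss β ρ π Θ Θhat R t |
      MeasurableSpace.comap (history π Θhat R t) inferInstance] :=
    (hI t ht).2.mono fun ω h => h.1
  calc ∑ t ∈ Finset.range T, ∫⁻ ω, ENNReal.ofReal (μ[excessLogLoss β ρ π Θ Θhat R t |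
          MeasurableSpace.comap (history π Θhat R t) inferInstance] ω) ∂μ
      = ∑ t ∈ Finset.range T, ENNReal.ofReal (∫ ω, excessLogLoss β ρ π Θ Θhat R t ω ∂μ) := by
        refine Finset.sum_congr rfl fun t ht => ?_
        rw [← ofReal_integral_eq_lintegral_ofReal integrable_condExp (hnn t ht),
          integral_condExp (hHm t)]
    _ = ENNReal.ofReal (∫ ω, ∑ t ∈ Finset.range T, excessLogLoss β ρ π Θ Θhat R t ω ∂μ) := by
        rw [integral_finsetSum _ fun t ht => (hI t ht).1, ENNReal.ofReal_sum_of_nonneg]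
        intro t ht
        rw [← integral_condExp (hHm t)]
        exact integral_nonneg_of_ae (hnn t ht)
    _ ≤ ∫⁻ ω, ENNReal.ofReal (∑ t ∈ Finset.range T, excessLogLoss β ρ π Θ Θhat R t ω) ∂μ := by
        rw [integral_eq_lintegral_pos_part_sub_lintegral_neg_part
          (integrable_finsetSum _ fun t ht => (hI t ht).1)]
        exact (ENNReal.ofReal_le_ofReal (sub_le_self _ ENNReal.toReal_nonneg)).trans
          ENNReal.ofReal_toReal_le
    _ ≤ ∫⁻ ω, ENNReal.ofReal (-Real.log (μ.real ((fun ω => q (Θ ω)) ⁻¹' {q (Θ ω)}))) +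
          ENNReal.ofReal (ε * β * T) ∂μ := by
        refine lintegral_mono_ae ?_
        have ha' : ∀ᵐ ω ∂μ, ∀ t < T, ‖π (Θhat t ω)‖ ≤ 1 :=
          ae_all_iff.mpr fun t => ae_all_iff.mpr fun ht => ha t ht
        filter_upwards [ha', hfix, hdist, ae_measureReal_preimage_singleton_pos hS hqS]
          with ω h1 h2 h3 h4
        have h5 : ρ.real {q (Θ ω)} = μ.real ((fun ω => q (Θ ω)) ⁻¹' {q (Θ ω)}) :=
          map_measureReal_apply hqΘ (measurableSet_singleton _)
        rw [← h5] at h4 ⊢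
        have h6 : 0 ≤ -Real.log (ρ.real {q (Θ ω)}) :=
          neg_nonneg.mpr (Real.log_nonpos measureReal_nonneg measureReal_le_one)
        rw [← ENNReal.ofReal_add h6 (by positivity)]
        refine ENNReal.ofReal_le_ofReal ?_
        rw [sum_excessLogLoss, h2]
        have h7 (s : Fin T) : ‖(history π Θhat R T ω s).1‖ ≤ 1 := h1 s s.2
        exact log_likelihood_div_mixtureLikelihood_le ρ hβ h7 h3 h4
    _ ≤ _ := by
        rw [lintegral_add_right _ measurable_const, lintegral_const, measure_univ, mul_one]
        gcongr
        exact lintegral_neg_log_measureReal_le_entropy hqΘ hS hqS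

end ThompsonSampling

end LogisticBandit

open LogisticBandit in
theorem theorem1 {Ω : Type*} [MeasurableSpace Ω] (μ : Measure Ω) [IsProbabilityMeasure μ]
    {d : ℕ} (β : ℝ) (hβ : 0 < β) (A O : Set (EuclideanSpace ℝ (Fin d)))
    (hA : A ⊆ Metric.closedBall 0 1) (hO : O ⊆ Metric.sphere 0 1) (hOA : O ⊆ A)
    (π : EuclideanSpace ℝ (Fin d) → EuclideanSpace ℝ (Fin d)) (hπm : Measurable π)
    (hπ : LogisticBandit.IsOptimalMapping β A O π)
    (T : ℕ) (hT : 1 ≤ T)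
    (Θ : Ω → EuclideanSpace ℝ (Fin d)) (Θhat : ℕ → Ω → EuclideanSpace ℝ (Fin d))
    (R Ropt : ℕ → Ω → Bool)
    (hΘ : ∀ᵐ ω ∂μ, Θ ω ∈ O)
    (hTS : LogisticBandit.IsThompsonSampling μ β π T Θ Θhat R Ropt)
    (ε : ℝ) (hε : 0 < ε) (N : Set (EuclideanSpace ℝ (Fin d)))
    (q : EuclideanSpace ℝ (Fin d) → EuclideanSpace ℝ (Fin d))
    (hq : LogisticBandit.IsNetProjection O N ε q)
    (Γ : ℝ) (hΓ : 0 < Γ)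
    (hratio : (∑ t ∈ Finset.range T,
      ∫⁻ ω, LogisticBandit.infoRatio μ π Θ Θhat R Ropt t ω ∂μ) / (T : ℝ≥0∞) ≤ ENNReal.ofReal Γ) :
    ENNReal.ofReal (LogisticBandit.expectedRegret μ R Ropt T) ≤
      (ENNReal.ofReal Γ * (T : ℝ≥0∞) *
        (LogisticBandit.entropy μ (fun ω => q (Θ ω)) + ENNReal.ofReal (ε * β * T))) ^ (1 / 2 : ℝ) := by
  have hT0 : (T : ℝ≥0∞) ≠ 0 := by exact_mod_cast (by omega : T ≠ 0)
  have hΓ0 : ENNReal.ofReal Γ ≠ 0 := (ENNReal.ofReal_pos.mpr hΓ).ne'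
  by_cases hdisc : ∃ S : Set (EuclideanSpace ℝ (Fin d)), S.Countable ∧ ∀ᵐ ω ∂μ, q (Θ ω) ∈ S
  swap
  -- If `q(Θ)` is not discrete, the entropy and the right-hand side are infinite.
  · have h : entropy μ (fun ω => q (Θ ω)) = ∞ := if_neg hdisc
    rw [h, top_add, ENNReal.mul_top (mul_ne_zero hΓ0 hT0), ENNReal.top_rpow_of_pos (by norm_num)]
    exact le_top
  obtain ⟨S, hS, hqS⟩ := hdisc
  have hΘm := hTS.measurable_param
  have hqΘ : Measurable fun ω => q (Θ ω) := hq.measurable.comp hΘm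
  have hfix : ∀ θ ∈ O, π θ = θ := fun θ hθ => hπ.apply_eq_self hβ hA hO hOA hθ
  have hπΘ : ∀ᵐ ω ∂μ, π (Θ ω) = Θ ω := hΘ.mono fun ω => hfix _
  have hΘ1 : ∀ᵐ ω ∂μ, ‖Θ ω‖ ≤ 1 := hΘ.mono fun ω hω => by
    simpa using Metric.sphere_subset_closedBall (hO hω)
  -- `O` need not be measurable, so the estimates are controlled through a measurable superset.
  have hact t (ht : t < T) : ∀ᵐ ω ∂μ, ‖π (Θhat t ω)‖ ≤ 1 := by
    refine hTS.ae_estimate_mem hπm (S := {θ | ‖π θ‖ ≤ 1})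
      (measurableSet_le hπm.norm measurable_const) ?_ ht
    filter_upwards [hπΘ, hΘ1] with ω h1 h2
    exact (congrArg norm h1).trans_le h2
  set ρ := μ.map fun ω => q (Θ ω)
  have : IsProbabilityMeasure ρ := Measure.isProbabilityMeasure_map hqΘ.aemeasurable
  set J : ℕ → Ω → ℝ := fun t => μ[excessLogLoss β ρ π Θ Θhat R t |
    MeasurableSpace.comap (history π Θhat R t) inferInstance]
  set D : ℕ → Ω → ℝ := fun t => μ[fun ω' => rewardValue (Ropt t ω') - rewardValue (R t ω') |
      MeasurableSpace.comap (history π Θhat R t) inferInstance] with hD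
  have hHm t := (hTS.measurable_history hπm t).comap_le
  have hI t (ht : t < T) := hTS.condMutualInfo_le hβ hπm ht hπΘ hΘ1 (hact t ht) ρ
  have hsum : ∑ t ∈ Finset.range T, ∫⁻ ω, infoRatio μ π Θ Θhat R Ropt t ω ∂μ ≤
      ENNReal.ofReal Γ * T :=
    (ENNReal.div_le_iff hT0 (ENNReal.natCast_ne_top T)).mp hratio
  have hfin t (ht : t ∈ Finset.range T) : ∫⁻ ω, infoRatio μ π Θ Θhat R Ropt t ω ∂μ ≠ ∞ :=
    (((Finset.single_le_sum (fun _ _ => zero_le) ht).trans hsum).trans_lt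
      (ENNReal.mul_lt_top ENNReal.ofReal_lt_top (ENNReal.natCast_lt_top T))).ne
  have hround t (ht : t ∈ Finset.range T) : ENNReal.ofReal (∫ ω, D t ω ∂μ) ≤
      (∫⁻ ω, infoRatio μ π Θ Θhat R Ropt t ω ∂μ) ^ (1 / 2 : ℝ) *
        (∫⁻ ω, ENNReal.ofReal (J t ω) ∂μ) ^ (1 / 2 : ℝ) := by
    refine ofReal_integral_le_of_sq_div_le integrable_condExp.aestronglyMeasurable.aemeasurable
      integrable_condExp.aestronglyMeasurable.aemeasurable ?_ (hfin t ht)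
    filter_upwards [(hI t (Finset.mem_range.mp ht)).2] with ω hω
    -- Enlarging the information decreases the ratio.
    exact ENNReal.div_le_div_left hω.2 _
  have hinfo : ∑ t ∈ Finset.range T, ∫⁻ ω, ENNReal.ofReal (J t ω) ∂μ ≤
      entropy μ (fun ω => q (Θ ω)) + ENNReal.ofReal (ε * β * T) :=
    hTS.sum_lintegral_condExp_excessLogLoss_le hβ hπm hπΘ hΘ1 hact hq.measurable hε
      (hΘ.mono fun ω => hq.dist_le _) hS hqS
  have hval (P : Ω → Bool) (hP : Measurable P) : Integrable (fun ω => rewardValue (P ω)) μ := by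
    refine Integrable.of_bound (C := 1)
      ((Measurable.of_discrete (f := rewardValue)).comp hP).aestronglyMeasurable
      (.of_forall fun ω => ?_)
    cases h : P ω <;> simp [rewardValue]
  have hdiff t : Integrable (fun ω => rewardValue (Ropt t ω) - rewardValue (R t ω)) μ :=
    (hval _ (hTS.measurable_optReward t)).sub (hval _ (hTS.measurable_reward t))
  calc ENNReal.ofReal (expectedRegret μ R Ropt T)
      = ENNReal.ofReal (∑ t ∈ Finset.range T, ∫ ω, D t ω ∂μ) := by
        rw [expectedRegret, integral_finsetSum _ fun t _ => hdiff t]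
        simp_rw [hD, integral_condExp (hHm _)]
    _ ≤ ∑ t ∈ Finset.range T, ENNReal.ofReal (∫ ω, D t ω ∂μ) := by
        exact Finset.le_sum_of_subadditive _ ENNReal.ofReal_zero.le
          (fun _ _ => ENNReal.ofReal_add_le) _ _
    _ ≤ ∑ t ∈ Finset.range T, (∫⁻ ω, infoRatio μ π Θ Θhat R Ropt t ω ∂μ) ^ (1 / 2 : ℝ) *
        (∫⁻ ω, ENNReal.ofReal (J t ω) ∂μ) ^ (1 / 2 : ℝ) := Finset.sum_le_sum hround
    _ ≤ _ := sum_rpow_half_mul_le _ _ _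
    _ ≤ _ := by gcongr
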